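/- Let $X \neq \{0\}$ be a real Banach space with closed unit ball $B_X$ and unit sphere $S_X$. A *slice* of $B_X$ is a set $\{x \in B_X : x^*(x) > 1-\varepsilon\}$ with $x^* \in X^*$, $\|x^*\| = 1$ and $\varepsilon > 0$. Suppose that $X$ has the *strong diameter 2 property* (SD2P): for all $n \ge 1$, all slices $S_1,\dots,S_n$ of $B_X$ and all $\lambda_1,\dots,\lambda_n \ge 0$ with $\sum_{i=1}^n \lambda_i = 1$, the set $\sum_{i=1}^n \lambda_i S_i = \{\sum_{i=1}^n \lambda_i x_i : x_i \in S_i\}$ has diameter $2$. Then the bidual $X^{**}$ is neither strictly convex nor smooth. Here a Banach space $E$ is *strictly convex* if $\|\frac{x+y}{2}\| < 1$ for all $x \neq y$ in $S_E$, and *smooth* if for every $x \in S_E$ there is exactly one $f \in S_{E^*}$ with $f(x) = 1$. -/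

import Mathlib

/-- The slice `S(f, ε) = {x ∈ B_X : f x > 1 - ε}` of the closed unit ball of a real normed space
(used only for `‖f‖ = 1` and `ε > 0`). -/
def ballSlice {X : Type*} [NormedAddCommGroup X] [NormedSpace ℝ X]
    (f : StrongDual ℝ X) (ε : ℝ) : Set X :=
  {x | x ∈ Metric.closedBall (0 : X) 1 ∧ 1 - ε < f x}

/-- The strong diameter 2 property: every finite convex combination
`∑ i, c i • S (f i, ε i)` (elementwise sum of sets) of slices of the unit ball has diameter 2. -/
def StrongDiameterTwo (X : Type*) [NormedAddCommGroup X] [NormedSpace ℝ X] : Prop :=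
  ∀ (n : ℕ) (f : Fin n → StrongDual ℝ X) (ε c : Fin n → ℝ),
    (∀ i, ‖f i‖ = 1) → (∀ i, 0 < ε i) → (∀ i, 0 ≤ c i) → ∑ i, c i = 1 →
      Metric.diam {z : X | ∃ x : Fin n → X,
        (∀ i, x i ∈ ballSlice (f i) (ε i)) ∧ z = ∑ i, c i • x i} = 2

/-- The norm of `E` is smooth: every point of the unit sphere has exactly one norm-one
supporting functional. -/
def SmoothNorm (E : Type*) [NormedAddCommGroup E] [NormedSpace ℝ E] : Prop :=
  ∀ x : E, ‖x‖ = 1 → ∃! f : StrongDual ℝ E, ‖f‖ = 1 ∧ f x = 1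

open Filter Topology

/-! SD2P makes the dual octahedral: given `g` and `h`, some `f` in the dual ball has almost additive
norm with `g`, `h` and `-h` (`StrongDiameterTwo.exists_norm_add_ge`). Iterating gives `f i` such
that both `∑ f i` and `∑ (-1)^i f i` have almost maximal norm. Weak-* compactness then yields bidual
elements `φ`, `ψ` with `φ (f i) → 1` and `(-1)^i ψ (f i) → 1`, so `φ ± ψ` both have norm 2. Such a
pair contradicts strict convexity and smoothness. -/

/-- Every vector of a nontrivial real normed space is its norm times a unit vector. -/
lemma exists_unit_smul_eq {E : Type*} [NormedAddCommGroup E] [NormedSpace ℝ E] [Nontrivial E]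
    (g : E) : ∃ u : E, ‖u‖ = 1 ∧ g = ‖g‖ • u := by
  by_cases hg : g = 0
  · obtain ⟨u, hu⟩ := exists_norm_eq E (zero_le_one' ℝ)
    exact ⟨u, hu, by simp [hg]⟩
  · have h : ‖g‖ ≠ 0 := norm_ne_zero_iff.2 hg
    exact ⟨‖g‖⁻¹ • g, by rw [norm_smul, norm_inv, norm_norm, inv_mul_cancel₀ h],
      by rw [smul_smul, mul_inv_cancel₀ h, one_smul]⟩

/-- On a thin enough slice a functional is close to its norm. -/
lemma exists_ballSlice_forall_norm_sub_le {X : Type*} [NormedAddCommGroup X] [NormedSpace ℝ X]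
    [Nontrivial (StrongDual ℝ X)] (g : StrongDual ℝ X) {δ : ℝ} (hδ : 0 < δ) :
    ∃ (u : StrongDual ℝ X) (ε : ℝ), ‖u‖ = 1 ∧ 0 < ε ∧
      ∀ x ∈ ballSlice u ε, ‖x‖ ≤ 1 ∧ ‖g‖ - δ ≤ g x := by
  obtain ⟨u, hu, hg⟩ := exists_unit_smul_eq g
  have hpos : 0 < 1 + ‖g‖ := by positivity
  refine ⟨u, δ / (1 + ‖g‖), hu, by positivity, fun x hx => ⟨by simpa using hx.1, ?_⟩⟩
  have hgx : g x = ‖g‖ * u x := by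
    conv_lhs => rw [hg]
    simp
  have h1 : ‖g‖ * (1 - δ / (1 + ‖g‖)) ≤ ‖g‖ * u x :=
    mul_le_mul_of_nonneg_left hx.2.le (norm_nonneg _)
  have h2 : ‖g‖ * (δ / (1 + ‖g‖)) ≤ δ := by
    rw [mul_div_assoc', div_le_iff₀ hpos]
    nlinarith
  rw [hgx]
  linarith

lemma apply_le_norm_of_norm_le_one {E : Type*} [NormedAddCommGroup E] [NormedSpace ℝ E]
    (f : StrongDual ℝ E) {x : E} (hx : ‖x‖ ≤ 1) : |f x| ≤ ‖f‖ :=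
  (f.le_opNorm x).trans (mul_le_of_le_one_right (norm_nonneg _) hx)

lemma abs_apply_le_one {E : Type*} [NormedAddCommGroup E] [NormedSpace ℝ E]
    {f : StrongDual ℝ E} (hf : ‖f‖ ≤ 1) {x : E} (hx : ‖x‖ ≤ 1) : |f x| ≤ 1 :=
  (apply_le_norm_of_norm_le_one f hx).trans hf

/-- The dual of a space with the strong diameter 2 property is octahedral, for two functionals. -/
lemma StrongDiameterTwo.exists_norm_add_ge {X : Type*} [NormedAddCommGroup X] [NormedSpace ℝ X]
    [Nontrivial X] (hX : StrongDiameterTwo X) (g h : StrongDual ℝ X) {δ : ℝ} (hδ : 0 < δ)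
    (hδ1 : δ ≤ 1) :
    ∃ f : StrongDual ℝ X, ‖f‖ ≤ 1 ∧ ‖g‖ + 1 - δ ≤ ‖g + f‖ ∧
      ‖h‖ + 1 - δ ≤ ‖h + f‖ ∧ ‖h‖ + 1 - δ ≤ ‖h - f‖ := by
  obtain ⟨u, ε, hu, hε, hg⟩ := exists_ballSlice_forall_norm_sub_le g (half_pos hδ)
  obtain ⟨v, η, hv, hη, hh⟩ := exists_ballSlice_forall_norm_sub_le h (half_pos hδ)
  have hdiam := hX 2 ![u, v] ![ε, η] ![1 / 2, 1 / 2]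
    (by simp [Fin.forall_fin_two, hu, hv]) (by simp [Fin.forall_fin_two, hε, hη])
    (by simp [Fin.forall_fin_two]) (by simp [Fin.sum_univ_two]; norm_num)
  simp only [Fin.forall_fin_two, Fin.sum_univ_two, Matrix.cons_val_zero, Matrix.cons_val_one]
    at hdiam
  -- A functional `f` norming the difference satisfies `f (x 0) + f (x 1) - f (y 0) - f (y 1) > 4 -
  -- δ / 2`. Each term is at most 1, so each exceeds `1 - δ / 2`; the slices cost the other `δ / 2`.
  have hfar : ∃ x y : Fin 2 → X, (x 0 ∈ ballSlice u ε ∧ x 1 ∈ ballSlice v η) ∧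
      (y 0 ∈ ballSlice u ε ∧ y 1 ∈ ballSlice v η) ∧
      2 - δ / 4 < dist (((1 / 2 : ℝ) • x 0 + (1 / 2 : ℝ) • x 1))
        ((1 / 2 : ℝ) • y 0 + (1 / 2 : ℝ) • y 1) := by
    by_contra! hcon
    have hle := Metric.diam_le_of_forall_dist_le (C := 2 - δ / 4) (by linarith)
      (s := {z : X | ∃ x : Fin 2 → X, (x 0 ∈ ballSlice u ε ∧ x 1 ∈ ballSlice v η) ∧
        z = (1 / 2 : ℝ) • x 0 + (1 / 2 : ℝ) • x 1}) (by
          rintro _ ⟨x, hx, rfl⟩ _ ⟨y, hy, rfl⟩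
          exact hcon x y hx hy)
    rw [hdiam] at hle
    linarith
  obtain ⟨x, y, ⟨hx0, hx1⟩, ⟨hy0, hy1⟩, hxy⟩ := hfar
  obtain ⟨f, hf, hfz⟩ := exists_dual_vector'' ℝ
    (((1 / 2 : ℝ) • x 0 + (1 / 2 : ℝ) • x 1) - ((1 / 2 : ℝ) • y 0 + (1 / 2 : ℝ) • y 1))
  rw [dist_eq_norm] at hxy
  simp only [map_sub, map_add, map_smul, smul_eq_mul, RCLike.ofReal_real_eq_id, id] at hfz
  rw [← hfz] at hxy
  obtain ⟨nx0, gx0⟩ := hg _ hx0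
  obtain ⟨nx1, hx1⟩ := hh _ hx1
  obtain ⟨ny0, gy0⟩ := hg _ hy0
  obtain ⟨ny1, hy1⟩ := hh _ hy1
  have a0 := abs_le.1 (abs_apply_le_one hf nx0)
  have a1 := abs_le.1 (abs_apply_le_one hf nx1)
  have b0 := abs_le.1 (abs_apply_le_one hf ny0)
  have b1 := abs_le.1 (abs_apply_le_one hf ny1)
  have c0 := (abs_le.1 (apply_le_norm_of_norm_le_one (g + f) nx0)).2
  have c1 := (abs_le.1 (apply_le_norm_of_norm_le_one (h + f) nx1)).2
  have c2 := (abs_le.1 (apply_le_norm_of_norm_le_one (h - f) ny1)).2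
  simp only [add_apply, sub_apply] at c0 c1 c2
  exact ⟨f, hf, by linarith, by linarith, by linarith⟩

/-- If the partial sums of a sequence in the unit ball have almost maximal norm, then some
functional in the dual unit ball tends to `1` along the sequence. -/
lemma exists_dual_tendsto_one {E : Type*} [NormedAddCommGroup E] [NormedSpace ℝ E]
    (x : ℕ → E) (hx : ∀ i, ‖x i‖ ≤ 1)
    (hsum : ∀ n : ℕ, (n : ℝ) - 1 ≤ ‖∑ i ∈ Finset.range n, x i‖) :
    ∃ φ : StrongDual ℝ E, ‖φ‖ ≤ 1 ∧ Tendsto (fun i => φ (x i)) atTop (𝓝 1) := by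
  let B : Set (WeakDual ℝ E) := WeakDual.toStrongDual ⁻¹' Metric.closedBall 0 1
  have hB : IsCompact B := WeakDual.isCompact_closedBall 0 1
  have hBx : ∀ φ ∈ B, ∀ i, φ (x i) ≤ 1 := fun φ hφ i =>
    (abs_le.1 (abs_apply_le_one (f := WeakDual.toStrongDual φ) (by simpa [B] using hφ) (hx i))).2
  -- The deficits `1 - φ (x i)` are nonnegative on `B`, so the `K n` decrease; a functional norming
  -- the `n`th partial sum lies in `K n`. A common point has summable deficits.
  let K : ℕ → Set (WeakDual ℝ E) :=
    fun n => B ∩ {φ | ∑ i ∈ Finset.range n, (1 - φ (x i)) ≤ 1}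
  have hclosed : ∀ n, IsClosed {φ : WeakDual ℝ E | ∑ i ∈ Finset.range n, (1 - φ (x i)) ≤ 1} :=
    fun n => isClosed_le (continuous_finsetSum _ fun i _ =>
      continuous_const.sub (WeakDual.eval_continuous (x i))) continuous_const
  have hK : (⋂ n, K n).Nonempty := by
    refine IsCompact.nonempty_iInter_of_sequence_nonempty_isCompact_isClosed K ?_ ?_ ?_ ?_
    · rintro n φ ⟨hφ, hs⟩
      refine ⟨hφ, ?_⟩
      simp only [Set.mem_ofPred_eq, Finset.sum_range_succ] at hs ⊢
      linarith [hBx φ hφ n]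
    · intro n
      obtain ⟨φ, hφ, hφs⟩ := exists_dual_vector'' ℝ (∑ i ∈ Finset.range n, x i)
      refine ⟨StrongDual.toWeakDual φ, by simpa [B] using hφ, ?_⟩
      have h := hsum n
      simp only [map_sum, RCLike.ofReal_real_eq_id, id] at hφs
      have : ∑ i ∈ Finset.range n, (1 - φ (x i)) ≤ 1 := by
        rw [Finset.sum_sub_distrib, hφs]
        simp
        linarith
      exact this
    · exact hB.inter_right (hclosed 0)
    · exact fun n => hB.isClosed.inter (hclosed n)
  obtain ⟨φ, hφ⟩ := hK
  rw [Set.mem_iInter] at hφ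
  have hφB : φ ∈ B := (hφ 0).1
  have hs : Summable fun i => 1 - φ (x i) :=
    summable_of_sum_range_le (c := 1) (fun i => by linarith [hBx φ hφB i]) fun n => (hφ n).2
  refine ⟨WeakDual.toStrongDual φ, by simpa [B] using hφB, ?_⟩
  have := hs.tendsto_atTop_zero.const_sub 1
  simpa using this

/-- The bidual of a space with the strong diameter 2 property contains `ℓ₁²` isometrically. -/
lemma StrongDiameterTwo.exists_bidual_norm_add_sub {X : Type*} [NormedAddCommGroup X]
    [NormedSpace ℝ X] [Nontrivial X] (hX : StrongDiameterTwo X) :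
    ∃ φ ψ : StrongDual ℝ (StrongDual ℝ X), ‖φ‖ ≤ 1 ∧ ‖ψ‖ ≤ 1 ∧
      2 ≤ ‖φ + ψ‖ ∧ 2 ≤ ‖φ - ψ‖ := by
  have hδ : ∀ n : ℕ, (0 : ℝ) < (1 / 2) ^ (n + 1) := fun n => by positivity
  have hδ1 : ∀ n : ℕ, ((1 : ℝ) / 2) ^ (n + 1) ≤ 1 :=
    fun n => pow_le_one₀ (by norm_num) (by norm_num)
  choose F hF1 hFg hFh hFh' using
    fun (n : ℕ) (g h : StrongDual ℝ X) => hX.exists_norm_add_ge g h (hδ n) (hδ1 n)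
  -- The plain and alternating partial sums, built together so that each new `f n` suits both.
  let p : ℕ → StrongDual ℝ X × StrongDual ℝ X := fun n => Nat.rec (0, 0)
    (fun n q => (q.1 + F n q.1 q.2, q.2 + (-1 : ℝ) ^ n • F n q.1 q.2)) n
  let f : ℕ → StrongDual ℝ X := fun n => F n (p n).1 (p n).2
  have hf : ∀ n, ‖f n‖ ≤ 1 := fun n => hF1 _ _ _
  have hp1 : ∀ n, (p n).1 = ∑ i ∈ Finset.range n, f i := by
    intro n
    induction n with
    | zero => rfl
    | succ n ih => rw [Finset.sum_range_succ, ← ih]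
  have hp2 : ∀ n, (p n).2 = ∑ i ∈ Finset.range n, (-1 : ℝ) ^ i • f i := by
    intro n
    induction n with
    | zero => rfl
    | succ n ih => rw [Finset.sum_range_succ, ← ih]
  -- The losses `(1 / 2) ^ (i + 1)` for `i < n` add up to `1 - (1 / 2) ^ n`.
  have hn1 : ∀ n : ℕ, (n : ℝ) - 1 + (1 / 2) ^ n ≤ ‖(p n).1‖ := by
    intro n
    induction n with
    | zero => simp [p]
    | succ n ih =>
      have h := hFg n (p n).1 (p n).2
      change _ ≤ ‖(p n).1 + F n (p n).1 (p n).2‖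
      push_cast
      rw [pow_succ] at h ⊢
      linarith
  have hn2 : ∀ n : ℕ, (n : ℝ) - 1 + (1 / 2) ^ n ≤ ‖(p n).2‖ := by
    intro n
    induction n with
    | zero => simp [p]
    | succ n ih =>
      have h : ‖(p n).2‖ + 1 - (1 / 2) ^ (n + 1) ≤
          ‖(p n).2 + (-1 : ℝ) ^ n • F n (p n).1 (p n).2‖ := by
        rcases neg_one_pow_eq_or ℝ n with h | h
        · rw [h, one_smul]
          exact hFh _ _ _
        · have hneg : (-1 : ℝ) • F n (p n).1 (p n).2 = -F n (p n).1 (p n).2 := by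
            ext
            simp
          rw [h, hneg, ← sub_eq_add_neg]
          exact hFh' _ _ _
      change _ ≤ ‖(p n).2 + (-1 : ℝ) ^ n • F n (p n).1 (p n).2‖
      push_cast
      rw [pow_succ] at h ⊢
      linarith
  obtain ⟨φ, hφ, hφf⟩ := exists_dual_tendsto_one f hf fun n => by
    rw [← hp1]
    linarith [hn1 n, pow_pos (one_half_pos (α := ℝ)) n]
  obtain ⟨ψ, hψ, hψf⟩ := exists_dual_tendsto_one (fun i => (-1 : ℝ) ^ i • f i)
    (fun i => by simpa [norm_smul] using hf i) fun n => by
      rw [← hp2]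
      linarith [hn2 n, pow_pos (one_half_pos (α := ℝ)) n]
  -- Even indices norm `φ + ψ`, odd ones `φ - ψ`.
  have heven : Tendsto (fun n : ℕ => 2 * n) atTop atTop :=
    tendsto_id.const_mul_atTop' two_pos
  have hodd : Tendsto (fun n : ℕ => 2 * n + 1) atTop atTop :=
    tendsto_atTop_mono (fun n => Nat.le_succ _) heven
  refine ⟨φ, ψ, hφ, hψ, ?_, ?_⟩
  · have h := (hφf.comp heven).add (hψf.comp heven)
    norm_num at h
    refine le_of_tendsto' h fun n => ?_
    have := (abs_le.1 (apply_le_norm_of_norm_le_one (φ + ψ) (hf (2 * n)))).2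
    simpa using this
  · have h := (hφf.comp hodd).add (hψf.comp hodd)
    norm_num at h
    refine le_of_tendsto' h fun n => ?_
    have := (abs_le.1 (apply_le_norm_of_norm_le_one (φ - ψ) (hf (2 * n + 1)))).2
    simpa [pow_succ, ← sub_eq_add_neg] using this

/-- A smooth space does not contain `ℓ₁²` isometrically. -/
lemma not_smoothNorm_of_norm_add_sub {E : Type*} [NormedAddCommGroup E] [NormedSpace ℝ E]
    {φ ψ : E} (hφ : ‖φ‖ = 1) (hψ : ‖ψ‖ = 1) (hadd : 2 ≤ ‖φ + ψ‖) (hsub : 2 ≤ ‖φ - ψ‖) :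
    ¬ SmoothNorm E := by
  intro hE
  obtain ⟨F, hF, hFs⟩ := exists_dual_vector ℝ (φ + ψ) (by linarith)
  obtain ⟨G, hG, hGs⟩ := exists_dual_vector ℝ (φ - ψ) (by linarith)
  simp only [map_add, map_sub, RCLike.ofReal_real_eq_id, id] at hFs hGs
  have h1 := abs_le.1 (abs_apply_le_one hF.le hφ.le)
  have h2 := abs_le.1 (abs_apply_le_one hF.le hψ.le)
  have h3 := abs_le.1 (abs_apply_le_one hG.le hφ.le)
  have h4 := abs_le.1 (abs_apply_le_one hG.le hψ.le)
  -- Both functionals equal 1 at `φ`, but at `ψ` they are 1 and -1.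
  have hFG : F = G := (hE φ hφ).unique ⟨hF, by linarith⟩ ⟨hG, by linarith⟩
  subst hFG
  linarith

/-- A strictly convex space does not contain `ℓ₁²` isometrically. -/
lemma not_strictConvexSpace_of_norm_add_sub {E : Type*} [NormedAddCommGroup E] [NormedSpace ℝ E]
    {φ ψ : E} (hφ : ‖φ‖ = 1) (hψ : ‖ψ‖ = 1) (hadd : 2 ≤ ‖φ + ψ‖) (hsub : 2 ≤ ‖φ - ψ‖) :
    ¬ StrictConvexSpace ℝ E := by
  intro hE
  have hne : φ ≠ ψ := by
    rintro rfl
    norm_num at hsub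
  have h := norm_add_lt_of_not_sameRay ((not_sameRay_iff_of_norm_eq (hφ.trans hψ.symm)).2 hne)
  linarith

theorem corollary2p5 (X : Type*) [NormedAddCommGroup X] [NormedSpace ℝ X] [CompleteSpace X]
    [Nontrivial X] (hX : StrongDiameterTwo X) :
    ¬ StrictConvexSpace ℝ (StrongDual ℝ (StrongDual ℝ X)) ∧
      ¬ SmoothNorm (StrongDual ℝ (StrongDual ℝ X)) := by
  obtain ⟨φ, ψ, hφ, hψ, hadd, hsub⟩ := hX.exists_bidual_norm_add_sub
  have h := norm_add_le φ ψ
  have hφ1 : ‖φ‖ = 1 := by linarith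
  have hψ1 : ‖ψ‖ = 1 := by linarith
  exact ⟨not_strictConvexSpace_of_norm_add_sub hφ1 hψ1 hadd hsub,
    not_smoothNorm_of_norm_add_sub hφ1 hψ1 hadd hsub⟩
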